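/- **Setting.** Let $n\ge 0$ and let $\mathfrak h$ be a complex vector space with basis $\beta^1,\dots,\beta^n,\alpha^1,\dots,\alpha^n$ and the symmetric bilinear form for which this basis is orthonormal. Let $M(1)=S(\mathfrak h\otimes t^{-1}\mathbb C[t^{-1}])$ be the Heisenberg vertex operator algebra of $\mathfrak h$: the operators $h(m)$ ($h\in\mathfrak h$, $m\in\mathbb Z$) on $M(1)$ satisfy $[h(m),h'(l)]=(h,h')\,m\,\delta_{m+l,0}$, $h(m)\mathbf 1=0$ for $m\ge 0$, $h(m)$ is multiplication by $h\otimes t^{m}$ for $m<0$, and for $v=h_1(-n_1)\cdots h_r(-n_r)\mathbf 1$ with $n_1,\dots,n_r\ge 1$ $$Y(v,z)=\sum_{m\in\mathbb Z}v_m z^{-m-1}={}^{\circ}_{\circ}\prod_{e=1}^r\frac{1}{(n_e-1)!}\Big(\frac{d}{dz}\Big)^{n_e-1}h_e(z){}^{\circ}_{\circ},\qquad h(z)=\sum_{m\in\mathbb Z}h(m)z^{-m-1},$$ where ${}^{\circ}_{\circ}\cdots{}^{\circ}_{\circ}$ places the operators $h(m)$ with $m<0$ to the left of those with $m\ge0$.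 Identify $h\in\mathfrak h$ with $h(-1)\mathbf 1\in M(1)$. **Definitions.** For a vertex algebra $V$ let $C_2(V)=\operatorname{span}_{\mathbb C}\{u_{-2}v: u,v\in V\}$. For a subspace $M\subseteq V$ let $r_{0,-1}(M)$ be the set of all $v\in V$ for which there is $m\ge0$ such that $v_{n_1}\cdots v_{n_t}v\in M$ for all $t\ge m$ and $n_1,\dots,n_t\in\{0,-1\}$. Let $sr_{0,-1}(M)$ be the set of all $v\in V$ such that for every $b\in V$ there is $m\ge0$ with $b_s(v_{n_1}\cdots v_{n_t}v)\in M$ and $(v_{n_1}\cdots v_{n_t}v)_s b\in M$ for all $t\ge m$ and $s,n_1,\dots,n_t\in\{0,-1\}$. The subspace $M$ is an *$MZ_{0,-1}$-subspace* of $V$ if $r_{0,-1}(M)=sr_{0,-1}(M)$. For a subspace $U$ of an associative unital algebra $A$ let $r(U)$ be the set of all $a\in A$ with $a^t\in U$ for all sufficiently large $t$, and $sr(U)$ the set of all $a\in A$ such that for all $b,c\in A$ one has $b\,a^t c\in U$ for all sufficiently large $t$; $U$ is a *Mathieu–Zhao subspace* of $A$ if $r(U)=sr(U)$. **Theorem.**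 For $1\le i\le n$ let $f_i:M(1)\to M(1)$ be the linear map $f_i(a)=\beta^i_1a-\alpha^i_{-1}a$. Let $0\le k\le n$. Then $$\sum_{i=1}^k f_i(M(1))+C_2(M(1))$$ is an $MZ_{0,-1}$-subspace of $M(1)$ if and only if $$\sum_{i=1}^k(\partial_{x_i}-\zeta_i)\,\mathbb C[\zeta_1,\dots,\zeta_n,x_1,\dots,x_n]$$ is a Mathieu–Zhao subspace of $\mathbb C[\zeta_1,\dots,\zeta_n,x_1,\dots,x_n]$. -/

import Mathlib

noncomputable section

/-! ### Mathieu–Zhao subspaces of associative algebras -/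

namespace MathieuZhao

variable {R A : Type*} [CommRing R] [Ring A] [Algebra R A]

/-- `r(U)`: all `a` such that `a ^ t ∈ U` for all sufficiently large `t`. -/
def radical (U : Submodule R A) : Set A :=
  {a | ∃ m : ℕ, 1 ≤ m ∧ ∀ t : ℕ, m ≤ t → a ^ t ∈ U}

/-- `sr(U)`: all `a` such that, for all `b, c`, `b * a ^ t * c ∈ U` for all sufficiently
large `t`. -/
def strongRadical (U : Submodule R A) : Set A :=
  {a | ∀ b c : A, ∃ m : ℕ, 1 ≤ m ∧ ∀ t : ℕ, m ≤ t → b * a ^ t * c ∈ U}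

/-- Mathieu–Zhao subspaces of an associative algebra. -/
def IsMZ (U : Submodule R A) : Prop :=
  radical U = strongRadical U

end MathieuZhao

/-! ### Notions attached to a state-field correspondence `Y`

These notions only involve the products `u_n v` on a vertex algebra `(V, Y, 𝟏)`. -/

namespace VOA

variable {V : Type*} [AddCommGroup V] [Module ℂ V]

/-- The mode `u_n`, where `Y(u, z) = ∑ u_n z ^ (-n-1)`. -/
def mode (Y : V →ₗ[ℂ] VertexOperator ℂ V) (u : V) (n : ℤ) : Module.End ℂ V :=
  VertexOperator.ncoeff (Y u) n

/-- `C₂(V)`, the span of all `u_{-2} v`. -/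
def C2 (Y : V →ₗ[ℂ] VertexOperator ℂ V) : Submodule ℂ V :=
  Submodule.span ℂ {x | ∃ u v : V, x = mode Y u (-2) v}

/-- `v_{n₁} v_{n₂} ⋯ v_{n_t} v` for the list `[n₁, …, n_t]`. -/
def iterProd (Y : V →ₗ[ℂ] VertexOperator ℂ V) (v : V) (ns : List ℤ) : V :=
  ns.foldr (fun n w => mode Y v n w) v

/-- A word in the letters `0` and `-1`. -/
def IsWord (ns : List ℤ) : Prop :=
  ∀ n ∈ ns, n = 0 ∨ n = -1

/-- `r_{0,-1}(M)`. -/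
def radical (Y : V →ₗ[ℂ] VertexOperator ℂ V) (M : Submodule ℂ V) : Set V :=
  {v | ∃ m : ℕ, ∀ ns : List ℤ, m ≤ ns.length → IsWord ns → iterProd Y v ns ∈ M}

/-- `lsr_{0,-1}(M)`. -/
def leftStrongRadical (Y : V →ₗ[ℂ] VertexOperator ℂ V) (M : Submodule ℂ V) : Set V :=
  {v | ∀ b : V, ∃ m : ℕ, ∀ ns : List ℤ, m ≤ ns.length → IsWord ns →
    ∀ s : ℤ, s = 0 ∨ s = -1 → mode Y b s (iterProd Y v ns) ∈ M}

/-- `rsr_{0,-1}(M)`. -/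
def rightStrongRadical (Y : V →ₗ[ℂ] VertexOperator ℂ V) (M : Submodule ℂ V) : Set V :=
  {v | ∀ w : V, ∃ m : ℕ, ∀ ns : List ℤ, m ≤ ns.length → IsWord ns →
    ∀ s : ℤ, s = 0 ∨ s = -1 → mode Y (iterProd Y v ns) s w ∈ M}

/-- `sr_{0,-1}(M)`. -/
def strongRadical (Y : V →ₗ[ℂ] VertexOperator ℂ V) (M : Submodule ℂ V) : Set V :=
  leftStrongRadical Y M ∩ rightStrongRadical Y M

/-- `M` is an `MZ_{0,-1}`-subspace. -/
def IsMZ (Y : V →ₗ[ℂ] VertexOperator ℂ V) (M : Submodule ℂ V) : Prop :=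
  radical Y M = strongRadical Y M

end VOA

/-! ### The Heisenberg vertex operator algebra -/

namespace Heisenberg

variable {ι : Type*}

/-- The underlying space `M(1) = S(𝔥 ⊗ t⁻¹ℂ[t⁻¹])` of the Heisenberg vertex operator algebra
of a complex space `𝔥` with a symmetric bilinear form and an orthonormal basis `(h_i)`, `i ∈ ι`.
The variable `X (i, m)` is `h_i(-m-1) 𝟏`, and the vacuum `𝟏` is the polynomial `1`. -/
abbrev Fock (ι : Type*) : Type _ := MvPolynomial (ι × ℕ) ℂ

/-- The operator `h_i(n) = h_i ⊗ tⁿ` on `M(1)` (the central element acts as `1`):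
multiplication by `h_i(n) 𝟏` for `n < 0`, and `n ∂/∂(h_i(-n) 𝟏)` for `n ≥ 0`
(so `h_i(0) = 0`). -/
def osc (i : ι) (n : ℤ) : Module.End ℂ (Fock ι) :=
  if n < 0 then LinearMap.mulLeft ℂ (MvPolynomial.X (i, (-n - 1).toNat))
  else (n : ℂ) • (MvPolynomial.pderiv (i, (n - 1).toNat)).toLinearMap

theorem pderiv_comm (a b : ι × ℕ) (w : Fock ι) :
    MvPolynomial.pderiv a (MvPolynomial.pderiv b w) =
      MvPolynomial.pderiv b (MvPolynomial.pderiv a w) := by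
  classical
  have h : ⁅(MvPolynomial.pderiv a : Derivation ℂ (Fock ι) (Fock ι)),
      (MvPolynomial.pderiv b : Derivation ℂ (Fock ι) (Fock ι))⁆ = 0 := by
    apply MvPolynomial.derivation_ext
    intro c
    simp [Derivation.commutator_apply, MvPolynomial.pderiv_X, Pi.single_apply, apply_ite]
  have := congrArg (fun D : Derivation ℂ (Fock ι) (Fock ι) => D w) h
  simpa [Derivation.commutator_apply, sub_eq_zero] using this

theorem osc_commute_neg (i i' : ι) {n n' : ℤ} (h : n < 0) (h' : n' < 0) :
    Commute (osc i n) (osc i' n') := by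
  ext1
  simp [osc, h, h', LinearMap.ext_iff, mul_left_comm]

theorem osc_commute_nonneg (i i' : ι) {n n' : ℤ} (h : 0 ≤ n) (h' : 0 ≤ n') :
    Commute (osc i n) (osc i' n') := by
  have hc : Commute (MvPolynomial.pderiv (i, (n - 1).toNat)).toLinearMap
      (MvPolynomial.pderiv (R := ℂ) (i', (n' - 1).toNat)).toLinearMap :=
    LinearMap.ext fun w => pderiv_comm _ _ w
  rw [osc, osc, if_neg h.not_gt, if_neg h'.not_gt]
  exact (hc.smul_left _).smul_right _

theorem osc_mixed (i i' : ι) {m n : ℤ} (hm : 0 ≤ m) (hn : n < 0) [Decidable (i = i' ∧ m + n = 0)] :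
    osc i m * osc i' n - osc i' n * osc i m =
      if i = i' ∧ m + n = 0 then (m : ℂ) • 1 else 0 := by
  classical
  refine LinearMap.ext fun w => ?_
  have key : (osc i m * osc i' n - osc i' n * osc i m) w =
      (m : ℂ) • (MvPolynomial.pderiv (i, (m - 1).toNat)
        (MvPolynomial.X (R := ℂ) (i', (-n - 1).toNat)) * w) := by
    rw [osc, osc, if_neg hm.not_gt, if_pos hn]
    simp only [LinearMap.sub_apply, Module.End.mul_apply, LinearMap.smul_apply,
      LinearMap.mulLeft_apply, Derivation.coeFn_coe, Derivation.leibniz, smul_eq_mul,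
      mul_smul_comm, smul_add]
    rw [add_sub_cancel_left, mul_comm w]
  rw [key]
  split_ifs with h
  · obtain ⟨rfl, h⟩ := h
    obtain rfl : n = -m := by omega
    simp
  · rcases eq_or_lt_of_le hm with rfl | hm'
    · simp
    · rw [MvPolynomial.pderiv_X_of_ne, zero_mul, smul_zero, LinearMap.zero_apply]
      intro hc
      simp only [Prod.mk.injEq] at hc
      exact h ⟨hc.1.symm, by omega⟩

open Classical in
/-- The Heisenberg relations `[h_i(m), h_{i'}(n)] = (h_i, h_{i'}) m δ_{m+n,0}`. -/
theorem osc_commutator (i i' : ι) (m n : ℤ) :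
    osc i m * osc i' n - osc i' n * osc i m =
      if i = i' ∧ m + n = 0 then (m : ℂ) • 1 else 0 := by
  rcases lt_or_ge m 0 with hm | hm <;> rcases lt_or_ge n 0 with hn | hn
  · rw [if_neg (by omega), sub_eq_zero]
    exact osc_commute_neg i i' hm hn
  · rw [← neg_sub, osc_mixed i' i hn hm]
    by_cases h : i = i' ∧ m + n = 0
    · rw [if_pos h, if_pos ⟨h.1.symm, by omega⟩]
      obtain rfl : m = -n := by omega
      rw [Int.cast_neg]
      exact (neg_smul _ _).symm
    · rw [if_neg h, if_neg fun h' => h ⟨h'.1.symm, by omega⟩, neg_zero]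
  · exact osc_mixed i i' hm hn
  · rw [sub_eq_zero.mpr (osc_commute_nonneg i i' hm hn)]
    split_ifs with h
    · obtain rfl : m = 0 := by omega
      simp
    · rfl

/-- `h_i(n) 𝟏 = 0` for `n ≥ 0`. -/
theorem osc_vacuum (i : ι) {n : ℤ} (h : 0 ≤ n) : osc i n 1 = 0 := by
  simp [osc, h.not_gt]

/-- For each `w`, the operators `h_i(n)` with `n` large annihilate `w`. -/
theorem exists_osc_bound (w : Fock ι) :
    ∃ N : ℤ, 0 ≤ N ∧ ∀ (i : ι) (n : ℤ), N < n → osc i n w = 0 := by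
  classical
  refine ⟨((w.vars.sup Prod.snd + 1 : ℕ) : ℤ), by positivity, fun i n hn => ?_⟩
  have hn0 : ¬ n < 0 := by omega
  have : (i, (n - 1).toNat) ∉ w.vars := by
    intro hm
    have := Finset.le_sup (f := Prod.snd) hm
    simp only at this
    omega
  rw [osc, if_neg hn0, LinearMap.smul_apply]
  exact (congrArg _ (MvPolynomial.pderiv_eq_zero_of_notMem_vars this)).trans (smul_zero _)

section Fields

variable {E : Type*} [Fintype E]

theorem pairwise_neg (a : E → ι × ℕ) (j : E → ℤ) :
    ((Finset.univ.filter fun e => j e < 0 : Finset E) : Set E).Pairwise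
      (Function.onFun Commute fun e : E => osc (a e).1 (j e)) :=
  fun _ he _ he' _ => osc_commute_neg _ _ (by simpa using he) (by simpa using he')

theorem pairwise_nonneg (a : E → ι × ℕ) (j : E → ℤ) :
    ((Finset.univ.filter fun e => 0 ≤ j e : Finset E) : Set E).Pairwise
      (Function.onFun Commute fun e : E => osc (a e).1 (j e)) :=
  fun _ he _ he' _ => osc_commute_nonneg _ _ (by simpa using he) (by simpa using he')

/-- The normally ordered product of the operators `h_{i_e}(j_e)`, where `e` runs over a finite set
and `a e = (i_e, m_e)`: the operators with `j_e < 0` stand to the left. -/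
def normalOrdered (a : E → ι × ℕ) (j : E → ℤ) : Module.End ℂ (Fock ι) :=
  (Finset.univ.filter fun e => j e < 0).noncommProd (fun e => osc (a e).1 (j e))
      (pairwise_neg a j) *
    (Finset.univ.filter fun e => 0 ≤ j e).noncommProd (fun e => osc (a e).1 (j e))
      (pairwise_nonneg a j)

/-- The contribution of the exponents `j` to
`:∏_e (1/m_e!) (d/dz)^{m_e} h_{i_e}(z):`, where `h(z) = ∑ h(j) z^(-j-1)`, so that
`(1/m!) (d/dz)^m h(z) = ∑ binom(-j-1, m) h(j) z^(-j-1-m)`. -/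
def fieldTerm (a : E → ι × ℕ) (j : E → ℤ) : Module.End ℂ (Fock ι) :=
  (∏ e : E, ((Ring.choose (-j e - 1) (a e).2 : ℤ) : ℂ)) • normalOrdered a j

/-- The power of `z` that goes with the exponents `j`. -/
def zPower (a : E → ι × ℕ) (j : E → ℤ) : ℤ :=
  ∑ e : E, (-j e - 1 - ((a e).2 : ℤ))

theorem fieldTerm_eq_zero (a : E → ι × ℕ) (w : Fock ι) {N : ℤ} (hN0 : 0 ≤ N)
    (hN : ∀ (i : ι) (n : ℤ), N < n → osc i n w = 0) (j : E → ℤ)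
    (e : E) (he : N < j e) : fieldTerm a j w = 0 := by
  classical
  have hmem : e ∈ Finset.univ.filter fun e => 0 ≤ j e := by
    simp; omega
  rw [fieldTerm, normalOrdered,
    ← Finset.noncommProd_erase_mul _ hmem _ (pairwise_nonneg a j)]
  simp [hN _ _ he]

theorem fieldTerm_finite (a : E → ι × ℕ) (q : ℤ) (w : Fock ι) :
    (Function.support fun j : {j : E → ℤ // zPower a j = q} =>
      fieldTerm a j w).Finite := by
  classical
  obtain ⟨N, hN0, hN⟩ := exists_osc_bound w
  set c : ℤ := ∑ e : E, (-1 - ((a e).2 : ℤ)) - q with hc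
  refine Set.Finite.of_finite_image (f := Subtype.val)
    ((Set.finite_Icc (fun _ : E => c - Fintype.card E * N)
      (fun _ => N)).subset ?_) Subtype.val_injective.injOn
  rintro _ ⟨⟨j, hj⟩, hne, rfl⟩
  have hle : ∀ e, j e ≤ N := fun e => by
    by_contra hlt
    exact hne (fieldTerm_eq_zero a w hN0 hN j e (not_le.mp hlt))
  refine ⟨fun e => ?_, hle⟩
  have hsum : ∑ e, j e = c := by
    rw [hc, ← hj, zPower, ← Finset.sum_sub_distrib]
    exact Finset.sum_congr rfl fun _ _ => by ring
  have h1 : ∑ e' ∈ Finset.univ.erase e, j e' ≤ Fintype.card E * N := by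
    calc ∑ e' ∈ Finset.univ.erase e, j e' ≤ ∑ _e' ∈ Finset.univ.erase e, N :=
          Finset.sum_le_sum fun e' _ => hle e'
      _ ≤ ∑ _e' : E, N :=
          Finset.sum_le_sum_of_subset_of_nonneg (Finset.erase_subset _ _) fun _ _ _ => hN0
      _ = _ := by simp
  have h2 := Finset.add_sum_erase Finset.univ j (Finset.mem_univ e)
  show c - Fintype.card E * N ≤ j e
  linarith

/-- The coefficient of `z ^ q` in `Y(v, z)`, for
`v = ∏_e h_{i_e}(-m_e-1) 𝟏`. The sum is finite on each vector. -/
def fieldCoeff (a : E → ι × ℕ) (q : ℤ) : Module.End ℂ (Fock ι) where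
  toFun w := ∑ᶠ j : {j : E → ℤ // zPower a j = q}, fieldTerm a j w
  map_add' w w' := by
    simp only [map_add]
    exact finsum_add_distrib (fieldTerm_finite a q w) (fieldTerm_finite a q w')
  map_smul' c w := by
    simp only [map_smul, RingHom.id_apply]
    exact (smul_finsum c _).symm

theorem fieldCoeff_apply (a : E → ι × ℕ) (q : ℤ) (w : Fock ι) :
    fieldCoeff a q w = ∑ᶠ j : {j : E → ℤ // zPower a j = q}, fieldTerm a j w := rfl

theorem fieldCoeff_bddBelow (a : E → ι × ℕ) (w : Fock ι) :
    BddBelow (Function.support fun q => fieldCoeff a q w) := by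
  obtain ⟨N, hN0, hN⟩ := exists_osc_bound w
  refine ⟨∑ e : E, (-N - 1 - ((a e).2 : ℤ)), fun q hq => ?_⟩
  obtain ⟨⟨j, hj⟩, hne⟩ : ∃ j : {j : E → ℤ // zPower a j = q},
      fieldTerm a j w ≠ 0 := by
    by_contra! hall
    exact hq (finsum_eq_zero_of_forall_eq_zero hall)
  rw [← hj]
  refine Finset.sum_le_sum fun e _ => ?_
  have : j e ≤ N := by
    by_contra hlt
    exact hne (fieldTerm_eq_zero a w hN0 hN j e (not_le.mp hlt))
  linarith

end Fields

/-- The factors of the monomial with exponents `s`: each variable `(i, m)` is counted with its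
multiplicity. -/
abbrev Factors (s : ι × ℕ →₀ ℕ) : Type _ := Σ a : s.support, Fin (s a)

/-- The variable `(i_e, m_e)` of which the factor `e` is a copy. -/
def Factors.var {s : ι × ℕ →₀ ℕ} (e : Factors s) : ι × ℕ := e.1

/-- The vertex operators of `M(1)`: for a monomial
`v = h_{i_1}(-m_1-1) ⋯ h_{i_k}(-m_k-1) 𝟏`,
`Y(v, z) = :∏_e (1/m_e!) (d/dz)^{m_e} h_{i_e}(z):`, extended linearly. -/
def Y (ι : Type*) : Fock ι →ₗ[ℂ] VertexOperator ℂ (Fock ι) :=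
  (MvPolynomial.basisMonomials (ι × ℕ) ℂ).constr ℂ fun s =>
    VertexOperator.of_coeff (fieldCoeff (Factors.var (s := s)))
      (fieldCoeff_bddBelow (Factors.var (s := s)))

/-- The vector `h_i = h_i(-1) 𝟏` of `M(1)`. -/
def gen (i : ι) : Fock ι := MvPolynomial.X (i, 0)

/-- The map `f_i = β^i_1 - α^i_{-1}` on `M(1)` for the space with orthonormal basis
`α^1, …, α^n` (indices `Sum.inl i`), `β^1, …, β^n` (indices `Sum.inr i`). -/
def f {n : ℕ} (i : Fin n) : Module.End ℂ (Fock (Fin n ⊕ Fin n)) :=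
  VOA.mode (Y (Fin n ⊕ Fin n)) (gen (Sum.inr i)) 1 -
    VOA.mode (Y (Fin n ⊕ Fin n)) (gen (Sum.inl i)) (-1)

end Heisenberg

/-- The operator `∂_{x_i} - ζ_i` on `ℂ[ζ_1, …, ζ_n, x_1, …, x_n]`, where `ζ_i` is the variable
`Sum.inl i` and `x_i` is the variable `Sum.inr i`. -/
def imageOp {n : ℕ} (i : Fin n) : Module.End ℂ (MvPolynomial (Fin n ⊕ Fin n) ℂ) :=
  (MvPolynomial.pderiv (Sum.inr i)).toLinearMap -
    LinearMap.mulLeft ℂ (MvPolynomial.X (Sum.inl i))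

end

/-!
On the `C₂`-quotient of `M(1)` the product `u_{-1} v` induces the multiplication of `S(𝔥)` and, `𝔥`
being abelian, `u_0 v` induces zero. An iterated product of `v` with modes `0` and `-1` therefore
becomes either zero or a power of the class of `v`, so the two radicals of a subspace containing
`C₂(M(1))` are the preimages of the radicals of its image in `S(𝔥)`. There `α^i_{-1}` acts as
multiplication by `ζ_i` and `β^i_1`, which is `∂/∂β^i(-1)`, acts as `∂_{x_i}`.
-/

namespace MathieuZhao

open Filter

theorem mem_radical_iff_eventually_pow_succ_mem {R A : Type*} [CommRing R] [Ring A] [Algebra R A]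
    {U : Submodule R A} {a : A} : a ∈ radical U ↔ ∀ᶠ t in atTop, a ^ (t + 1) ∈ U := by
  rw [eventually_atTop]
  constructor
  · rintro ⟨m, -, hm⟩
    exact ⟨m, fun t ht => hm (t + 1) (by omega)⟩
  · rintro ⟨m, hm⟩
    refine ⟨m + 1, by omega, fun t ht => ?_⟩
    have h := hm (t - 1) (by omega)
    rwa [Nat.sub_add_cancel (by omega)] at h

theorem mem_strongRadical_iff_forall_mem_radical {R A : Type*} [CommRing R] [CommRing A]
    [Algebra R A] {U : Submodule R A} {a : A} :
    a ∈ strongRadical U ↔ ∀ b, a ∈ radical (U.comap (LinearMap.mulLeft R b)) := by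
  constructor
  · intro ha b
    obtain ⟨m, hm1, hm⟩ := ha b 1
    exact ⟨m, hm1, fun t ht => by simpa using hm t ht⟩
  · intro ha b c
    obtain ⟨m, hm1, hm⟩ := ha (b * c)
    exact ⟨m, hm1, fun t ht => by
      simpa [mul_assoc, mul_comm c] using hm t ht⟩

end MathieuZhao

namespace VOA

open Filter

variable {V A : Type*} [AddCommGroup V] [Module ℂ V] [CommRing A] [Algebra ℂ A]
  {Y : V →ₗ[ℂ] VertexOperator ℂ V} {π : V →ₗ[ℂ] A}

/-- The map `π` identifies `A` with Zhu's `C₂`-algebra `V / C₂(V)`, whose product is induced by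
`u_{-1} v`, and the Poisson bracket induced by `u_0 v` vanishes. -/
structure IsC2QuotientMap (Y : V →ₗ[ℂ] VertexOperator ℂ V) (π : V →ₗ[ℂ] A) : Prop where
  surjective : Function.Surjective π
  ker_eq : LinearMap.ker π = C2 Y
  map_mode_zero : ∀ u v, π (mode Y u 0 v) = 0
  map_mode_neg_one : ∀ u v, π (mode Y u (-1) v) = π u * π v

namespace IsC2QuotientMap

variable (hπ : IsC2QuotientMap Y π)
include hπ

theorem map_iterProd (v : V) {ns : List ℤ} (hns : IsWord ns) :
    π (iterProd Y v ns) = if 0 ∈ ns then 0 else π v ^ (ns.length + 1) := by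
  induction ns with
  | nil => simp [iterProd]
  | cons n ns ih =>
    have htail : π (iterProd Y v ns) = _ := ih fun m hm => hns m (List.mem_cons_of_mem n hm)
    change π (mode Y v n (iterProd Y v ns)) = _
    rcases hns n List.mem_cons_self with rfl | rfl
    · simp [hπ.map_mode_zero]
    · simp [hπ.map_mode_neg_one, htail, pow_succ']

theorem mem_radical_comap_iff (U : Submodule ℂ A) (v : V) :
    v ∈ radical Y (U.comap π) ↔ π v ∈ MathieuZhao.radical U := by
  rw [MathieuZhao.mem_radical_iff_eventually_pow_succ_mem, eventually_atTop]
  refine exists_congr fun m => ⟨fun h t ht => ?_, fun h ns hlen hns => ?_⟩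
  · have hword : IsWord (List.replicate t (-1)) := fun n hn => .inr (List.eq_of_mem_replicate hn)
    simpa [hπ.map_iterProd v hword] using h _ (by simpa using ht) hword
  · rw [Submodule.mem_comap, hπ.map_iterProd v hns]
    split_ifs
    exacts [U.zero_mem, h _ hlen]

theorem mem_leftStrongRadical_comap_iff (U : Submodule ℂ A) (v : V) :
    v ∈ leftStrongRadical Y (U.comap π) ↔ π v ∈ MathieuZhao.strongRadical U := by
  simp only [MathieuZhao.mem_strongRadical_iff_forall_mem_radical, hπ.surjective.forall,
    ← hπ.mem_radical_comap_iff]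
  simp [leftStrongRadical, radical, or_imp, forall_and, hπ.map_mode_zero, hπ.map_mode_neg_one]

theorem rightStrongRadical_comap (U : Submodule ℂ A) :
    rightStrongRadical Y (U.comap π) = leftStrongRadical Y (U.comap π) := by
  ext v
  simp [leftStrongRadical, rightStrongRadical, or_imp, forall_and, hπ.map_mode_zero,
    hπ.map_mode_neg_one, mul_comm]

theorem isMZ_comap_iff (U : Submodule ℂ A) :
    IsMZ Y (U.comap π) ↔ MathieuZhao.IsMZ U := by
  have hr : radical Y (U.comap π) = π ⁻¹' MathieuZhao.radical U :=
    Set.ext (hπ.mem_radical_comap_iff U)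
  have hsr : strongRadical Y (U.comap π) = π ⁻¹' MathieuZhao.strongRadical U := by
    rw [strongRadical, hπ.rightStrongRadical_comap, Set.inter_self]
    exact Set.ext (hπ.mem_leftStrongRadical_comap_iff U)
  rw [IsMZ, hr, hsr, hπ.surjective.preimage_injective.eq_iff, MathieuZhao.IsMZ]

theorem iSup_range_sup_C2 {κ : Sort*} {F : κ → Module.End ℂ V} {G : κ → Module.End ℂ A}
    (hFG : ∀ i v, π (F i v) = G i (π v)) :
    (⨆ i, LinearMap.range (F i)) ⊔ C2 Y = (⨆ i, LinearMap.range (G i)).comap π := by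
  have hmap (i : κ) : (LinearMap.range (F i)).map π = LinearMap.range (G i) := by
    have hcomp : π ∘ₗ F i = G i ∘ₗ π := LinearMap.ext (hFG i)
    rw [← LinearMap.range_comp, hcomp,
      LinearMap.range_comp_of_range_eq_top _ (LinearMap.range_eq_top.2 hπ.surjective)]
  rw [← hπ.ker_eq, ← Submodule.comap_map_eq, Submodule.map_iSup]
  simp only [hmap]

theorem isMZ_iSup_range_sup_C2_iff {κ : Sort*} {F : κ → Module.End ℂ V}
    {G : κ → Module.End ℂ A} (hFG : ∀ i v, π (F i v) = G i (π v)) :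
    IsMZ Y ((⨆ i, LinearMap.range (F i)) ⊔ C2 Y) ↔
      MathieuZhao.IsMZ (⨆ i, LinearMap.range (G i)) := by
  rw [hπ.iSup_range_sup_C2 hFG, hπ.isMZ_comap_iff]

end IsC2QuotientMap

end VOA

theorem noncommProd_map_eq_map_prod {E M N F : Type*} [CommMonoid M] [Monoid N] [FunLike F M N]
    [MonoidHomClass F M N] (φ : F) (s : Finset E) (x : E → M)
    (comm : (s : Set E).Pairwise (Function.onFun Commute fun e => φ (x e))) :
    s.noncommProd (fun e => φ (x e)) comm = φ (∏ e ∈ s, x e) := by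
  rw [← Finset.noncommProd_eq_prod]
  exact (Finset.map_noncommProd s x (fun _ _ _ _ _ => .all _ _) φ).symm

theorem ring_choose_eq_zero_of_lt {r : ℤ} {m : ℕ} (hr : 0 ≤ r) (hrm : r < m) :
    Ring.choose r m = 0 := by
  lift r to ℕ using hr
  rw [Ring.choose_natCast, Nat.choose_eq_zero_of_lt (by omega), Nat.cast_zero]

section KillCompl

open MvPolynomial

variable {σ τ R : Type*} [CommSemiring R] {g : σ → τ} (hg : Function.Injective g)

theorem killCompl_X_of_notMem_range {a : τ} (ha : a ∉ Set.range g) :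
    killCompl hg (X a : MvPolynomial τ R) = 0 := by
  simp [killCompl, ha]

theorem killCompl_X_apply (i : σ) : killCompl hg (X (g i) : MvPolynomial τ R) = X i := by
  rw [← rename_X, killCompl_rename_app]

theorem pderiv_killCompl (i : σ) (p : MvPolynomial τ R) :
    pderiv i (killCompl hg p) = killCompl hg (pderiv (g i) p) := by
  classical
  induction p using MvPolynomial.induction_on with
  | C c => simp
  | add p q hp hq => simp only [map_add, hp, hq]
  | mul_X p a hp =>
    have hX : pderiv i (killCompl hg (X a : MvPolynomial τ R)) =
        killCompl hg (pderiv (g i) (X a)) := by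
      by_cases ha : a ∈ Set.range g
      · obtain ⟨j, rfl⟩ := ha
        by_cases hij : j = i <;> simp [killCompl_X_apply, pderiv_X, hij, hg.eq_iff]
      · have hai : a ≠ g i := fun h => ha ⟨i, h.symm⟩
        simp [killCompl_X_of_notMem_range hg ha, pderiv_X_of_ne hai]
    simp only [map_mul, Derivation.leibniz, smul_eq_mul, map_add, hp, hX]

theorem mem_span_X_of_killCompl_eq_zero {p : MvPolynomial τ R} (hp : killCompl hg p = 0) :
    p ∈ Ideal.span (X '' (Set.range g)ᶜ) := by
  refine mem_ideal_span_X_image.2 fun s hs => ?_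
  by_contra! hrange
  obtain ⟨t, rfl⟩ := (Finsupp.mem_range_mapDomain_iff g hg s).2 hrange
  rw [mem_support_iff, ← coeff_killCompl hg, hp, coeff_zero] at hs
  exact hs rfl

end KillCompl

namespace Heisenberg

open MvPolynomial

variable {ι : Type*}

/-- The algebra map `M(1) → S(𝔥)` that sends `h_i(-1) 𝟏` to `h_i` and kills `h_i(-m-1) 𝟏` for
`m ≥ 1`; it realizes `S(𝔥)` as the `C₂`-algebra of `M(1)`. -/
noncomputable def zhuMap (ι : Type*) : Fock ι →ₐ[ℂ] MvPolynomial ι ℂ :=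
  killCompl (Prod.mk_left_injective 0)

theorem zhuMap_X_zero (i : ι) : zhuMap ι (X (i, 0)) = X i :=
  killCompl_X_apply _ i

theorem zhuMap_X_of_ne_zero (i : ι) {m : ℕ} (hm : m ≠ 0) : zhuMap ι (X (i, m)) = 0 :=
  killCompl_X_of_notMem_range _ (by simpa using hm.symm)

theorem zhuMap_pderiv (i : ι) (w : Fock ι) :
    zhuMap ι (pderiv (i, 0) w) = pderiv i (zhuMap ι w) :=
  (pderiv_killCompl _ i w).symm

theorem osc_of_neg (i : ι) {n : ℤ} (hn : n < 0) :
    osc i n = LinearMap.mulLeft ℂ (X (i, (-n - 1).toNat)) :=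
  if_pos hn

theorem osc_of_nonneg (i : ι) {n : ℤ} (hn : 0 ≤ n) :
    osc i n = (n : ℂ) • (pderiv (i, (n - 1).toNat)).toLinearMap :=
  if_neg hn.not_gt

section NormalOrdered

variable {E : Type*} [Fintype E] (a : E → ι × ℕ) (j : E → ℤ)

theorem zhuMap_normalOrdered_eq_zero (w : Fock ι) {e : E} (he : j e < -1) :
    zhuMap ι (normalOrdered a j w) = 0 := by
  classical
  have hmem : e ∈ Finset.univ.filter fun e => j e < 0 := by
    simp only [Finset.mem_filter_univ]
    omega
  rw [normalOrdered, ← Finset.mul_noncommProd_erase _ hmem _ (pairwise_neg a j),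
    Module.End.mul_apply, Module.End.mul_apply, osc_of_neg _ (by omega), LinearMap.mulLeft_apply,
    map_mul, zhuMap_X_of_ne_zero _ (by omega), zero_mul]

theorem normalOrdered_eq_zero {e : E} (he : j e = 0) : normalOrdered a j = 0 := by
  classical
  have hmem : e ∈ Finset.univ.filter fun e => 0 ≤ j e := by simp [he]
  have hosc : osc (a e).1 (j e) = 0 := by simp [he, osc_of_nonneg]
  rw [normalOrdered, ← Finset.mul_noncommProd_erase _ hmem _ (pairwise_nonneg a j), hosc,
    zero_mul, mul_zero]

theorem normalOrdered_of_neg {j : E → ℤ} (hj : ∀ e, j e < 0) :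
    normalOrdered a j = Algebra.lmul ℂ (Fock ι) (∏ e, X ((a e).1, (-j e - 1).toNat)) := by
  have hosc (e : E) : osc (a e).1 (j e) =
      Algebra.lmul ℂ (Fock ι) (X ((a e).1, (-j e - 1).toNat)) := osc_of_neg _ (hj e)
  simp only [normalOrdered, hosc, hj, (hj _).not_ge, Finset.filter_true, Finset.filter_false]
  exact (mul_one _).trans (noncommProd_map_eq_map_prod (Algebra.lmul ℂ (Fock ι)) _ _ _)

theorem normalOrdered_of_unique [Unique E] :
    normalOrdered a j = osc (a default).1 (j default) := by
  rcases lt_or_ge (j default) 0 with h | h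
  · simp only [normalOrdered, Finset.univ_unique, Finset.filter_singleton, h, h.not_ge, if_true,
      if_false, Finset.noncommProd_singleton]
    exact mul_one _
  · simp only [normalOrdered, Finset.univ_unique, Finset.filter_singleton, h, h.not_gt, if_true,
      if_false, Finset.noncommProd_singleton]
    exact one_mul _

end NormalOrdered

section Fields

variable {E : Type*} [Fintype E] (a : E → ι × ℕ)

theorem eq_neg_one_or_pos_of_zhuMap_fieldTerm_ne_zero {a : E → ι × ℕ} {j : E → ℤ} {w : Fock ι}
    (h : zhuMap ι (fieldTerm a j w) ≠ 0) (e : E) :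
    j e = -1 ∧ (a e).2 = 0 ∨ 0 < j e := by
  rw [fieldTerm, LinearMap.smul_apply, map_smul, smul_ne_zero_iff, Finset.prod_ne_zero_iff] at h
  obtain ⟨hchoose, hprod⟩ := h
  have hge : -1 ≤ j e := by
    by_contra! hlt
    exact hprod (zhuMap_normalOrdered_eq_zero a j w hlt)
  have hne : j e ≠ 0 := fun h0 => hprod (by simp [normalOrdered_eq_zero a j h0])
  have hm : j e = -1 → (a e).2 = 0 := fun hj => by
    by_contra hm
    exact hchoose e (Finset.mem_univ e) (by
      rw [ring_choose_eq_zero_of_lt (by omega) (by omega), Int.cast_zero])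
  omega

theorem eq_neg_one_of_zhuMap_fieldTerm_ne_zero {a : E → ι × ℕ} {j : E → ℤ} {w : Fock ι}
    (hq : -1 ≤ zPower a j) (h : zhuMap ι (fieldTerm a j w) ≠ 0) (e : E) :
    j e = -1 ∧ (a e).2 = 0 := by
  classical
  -- No surviving factor has a positive power of `z`, and one with `j e > 0` has a power `≤ -2`.
  have hrest : ∑ e' ∈ Finset.univ.erase e, (-j e' - 1 - ((a e').2 : ℤ)) ≤ 0 :=
    Finset.sum_nonpos fun e' _ => by
      have := eq_neg_one_or_pos_of_zhuMap_fieldTerm_ne_zero h e'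
      omega
  rw [zPower, ← Finset.add_sum_erase _ _ (Finset.mem_univ e)] at hq
  have := eq_neg_one_or_pos_of_zhuMap_fieldTerm_ne_zero h e
  omega

theorem zhuMap_fieldCoeff (q : ℤ) (w : Fock ι) :
    zhuMap ι (fieldCoeff a q w) =
      ∑ᶠ j : {j : E → ℤ // zPower a j = q}, zhuMap ι (fieldTerm a j w) :=
  map_finsum (zhuMap ι) (fieldTerm_finite a q w)

theorem zhuMap_fieldCoeff_eq_zero {q : ℤ} (hq : -1 ≤ q) (hq0 : q ≠ 0) (w : Fock ι) :
    zhuMap ι (fieldCoeff a q w) = 0 := by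
  rw [zhuMap_fieldCoeff]
  refine finsum_eq_zero_of_forall_eq_zero fun ⟨j, hj⟩ => ?_
  by_contra h
  have hcreation : ∀ e, j e = -1 ∧ (a e).2 = 0 :=
    eq_neg_one_of_zhuMap_fieldTerm_ne_zero (by rwa [hj]) h
  exact hq0 (hj ▸ Finset.sum_eq_zero fun e _ => by simp [hcreation e])

theorem zhuMap_fieldCoeff_zero (w : Fock ι) :
    zhuMap ι (fieldCoeff a 0 w) = zhuMap ι (∏ e, X (a e)) * zhuMap ι w := by
  have hj₀ : zPower a (fun e => -1 - ((a e).2 : ℤ)) = 0 :=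
    Finset.sum_eq_zero fun e _ => by ring
  rw [zhuMap_fieldCoeff, finsum_eq_single _ ⟨_, hj₀⟩]
  · rw [fieldTerm, LinearMap.smul_apply, normalOrdered_of_neg _ (fun e => by simp only; omega)]
    simp [Ring.choose_natCast]
  · rintro ⟨j, hj⟩ hne
    by_contra h
    have hcreation : ∀ e, j e = -1 ∧ (a e).2 = 0 :=
      eq_neg_one_of_zhuMap_fieldTerm_ne_zero (by simp [hj]) h
    exact hne (Subtype.ext (funext fun e => by simp [hcreation e]))

theorem fieldCoeff_of_unique [Unique E] (q : ℤ) :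
    fieldCoeff a q = ((Ring.choose (q + (a default).2) (a default).2 : ℤ) : ℂ) •
      osc (a default).1 (-q - 1 - (a default).2) := by
  refine LinearMap.ext fun w => ?_
  have hj₀ : zPower a (fun _ => -q - 1 - ((a default).2 : ℤ)) = q := by
    rw [zPower, Fintype.sum_unique]
    ring
  rw [fieldCoeff_apply, finsum_eq_single _ ⟨_, hj₀⟩]
  · rw [fieldTerm, normalOrdered_of_unique, Fintype.prod_unique]
    congr 4
    ring
  · rintro ⟨j, hj⟩ hne
    have hdefault : j default = -q - 1 - (a default).2 := by
      have := hj
      rw [zPower, Fintype.sum_unique] at this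
      omega
    refine absurd (Subtype.ext (funext fun e => ?_)) hne
    exact (congrArg j (Unique.eq_default e)).trans hdefault

end Fields

theorem prod_X_var (s : ι × ℕ →₀ ℕ) : ∏ e : Factors s, (X e.var : Fock ι) = monomial s 1 := by
  rw [Fintype.prod_sigma, monomial_eq, C_1, one_mul, Finsupp.prod,
    ← Finset.prod_coe_sort s.support fun a => (X a : Fock ι) ^ s a]
  simp [Factors.var]

theorem mode_monomial (s : ι × ℕ →₀ ℕ) (c : ℂ) (n : ℤ) :
    VOA.mode (Y ι) (monomial s c) n = c • fieldCoeff (Factors.var (s := s)) (-n - 1) := by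
  have hY : Y ι (monomial s 1) = VertexOperator.of_coeff (fieldCoeff (Factors.var (s := s)))
      (fieldCoeff_bddBelow (Factors.var (s := s))) := by
    rw [Y]
    simpa only [coe_basisMonomials] using (basisMonomials (ι × ℕ) ℂ).constr_basis ℂ _ s
  rw [← mul_one c, ← smul_eq_mul, ← smul_monomial, VOA.mode, map_smul, map_smul, hY,
    Pi.smul_apply, VertexOperator.ncoeff_of_coeff, smul_eq_mul, mul_one]

theorem mode_add (u v : Fock ι) (n : ℤ) :
    VOA.mode (Y ι) (u + v) n = VOA.mode (Y ι) u n + VOA.mode (Y ι) v n := by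
  simp only [VOA.mode, map_add, Pi.add_apply]

theorem zhuMap_mode_eq_zero (u w : Fock ι) {n : ℤ} (hn : n ≤ 0) (hn1 : n ≠ -1) :
    zhuMap ι (VOA.mode (Y ι) u n w) = 0 := by
  induction u using MvPolynomial.induction_on' with
  | monomial s c =>
    rw [mode_monomial, LinearMap.smul_apply, map_smul,
      zhuMap_fieldCoeff_eq_zero _ (by omega) (by omega), smul_zero]
  | add p q hp hq => rw [mode_add, LinearMap.add_apply, map_add, hp, hq, add_zero]

theorem zhuMap_mode_neg_one (u w : Fock ι) :
    zhuMap ι (VOA.mode (Y ι) u (-1) w) = zhuMap ι u * zhuMap ι w := by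
  induction u using MvPolynomial.induction_on' with
  | monomial s c =>
    rw [mode_monomial, LinearMap.smul_apply, map_smul, neg_neg, sub_self, zhuMap_fieldCoeff_zero,
      prod_X_var, ← smul_mul_assoc, ← map_smul, smul_monomial, smul_eq_mul, mul_one]
  | add p q hp hq => rw [mode_add, LinearMap.add_apply, map_add, hp, hq, map_add, add_mul]

instance uniqueFactorsSingle (a : ι × ℕ) : Unique (Factors (Finsupp.single a 1)) where
  default := ⟨⟨a, by simp⟩, ⟨0, by simp⟩⟩
  uniq := by
    rintro ⟨⟨b, hb⟩, k⟩
    obtain rfl : b = a := by simpa using hb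
    have : Subsingleton (Fin (Finsupp.single b 1 b)) := by
      rw [Finsupp.single_eq_same]
      infer_instance
    exact congrArg _ (Subsingleton.elim _ _)

theorem mode_X (i : ι) (m : ℕ) (n : ℤ) :
    VOA.mode (Y ι) (X (i, m)) n =
      ((Ring.choose (-n - 1 + m) m : ℤ) : ℂ) • osc i (n - m) := by
  rw [X, mode_monomial, fieldCoeff_of_unique, one_smul]
  change ((Ring.choose (-n - 1 + m) m : ℤ) : ℂ) • osc i (-(-n - 1) - 1 - m) = _
  rw [show -(-n - 1) - 1 - (m : ℤ) = n - m by ring]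

theorem mode_X_neg_two (i : ι) (m : ℕ) (w : Fock ι) :
    VOA.mode (Y ι) (X (i, m)) (-2) w = ((m + 1 : ℕ) : ℂ) • (X (i, m + 1) * w) := by
  have hchoose : -(-2 : ℤ) - 1 + m = ((m + 1 : ℕ) : ℤ) := by push_cast; ring
  have hindex : (-(-2 - (m : ℤ)) - 1).toNat = m + 1 := by omega
  rw [mode_X, LinearMap.smul_apply, osc_of_neg _ (by omega), hchoose, hindex, Ring.choose_natCast,
    Nat.choose_succ_self_right, Int.cast_natCast, LinearMap.mulLeft_apply]

theorem X_succ_mul_mem_C2 (i : ι) (m : ℕ) (w : Fock ι) : X (i, m + 1) * w ∈ VOA.C2 (Y ι) := by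
  have hm : ((m + 1 : ℕ) : ℂ) ≠ 0 := Nat.cast_ne_zero.2 m.succ_ne_zero
  rw [← Submodule.smul_mem_iff _ hm, ← mode_X_neg_two]
  exact Submodule.subset_span ⟨_, _, rfl⟩

theorem ker_zhuMap : LinearMap.ker (zhuMap ι).toLinearMap = VOA.C2 (Y ι) := by
  apply le_antisymm
  · intro u hu
    suffices ∀ w, u * w ∈ VOA.C2 (Y ι) by simpa using this 1
    have hspan := mem_span_X_of_killCompl_eq_zero (Prod.mk_left_injective 0) hu
    clear hu
    induction hspan using Submodule.span_induction with
    | mem u hu =>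
      obtain ⟨⟨i, _ | m⟩, hrange, rfl⟩ := hu
      · exact absurd ⟨i, rfl⟩ hrange
      · exact X_succ_mul_mem_C2 i m
    | zero => simp
    | add p q _ _ hp hq => exact fun w => by simpa only [add_mul] using add_mem (hp w) (hq w)
    | smul r p _ hp =>
      exact fun w => by simpa only [smul_eq_mul, mul_left_comm, mul_assoc] using hp (r * w)
  · refine Submodule.span_le.2 ?_
    rintro _ ⟨u, v, rfl⟩
    exact zhuMap_mode_eq_zero u v (by norm_num) (by norm_num)

theorem isC2QuotientMap_zhuMap : VOA.IsC2QuotientMap (Y ι) (zhuMap ι).toLinearMap where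
  surjective p := ⟨rename (·, 0) p, killCompl_rename_app _ p⟩
  ker_eq := ker_zhuMap
  map_mode_zero u v := zhuMap_mode_eq_zero u v le_rfl (by norm_num)
  map_mode_neg_one := zhuMap_mode_neg_one

theorem zhuMap_f {n : ℕ} (i : Fin n) (w : Fock (Fin n ⊕ Fin n)) :
    zhuMap _ (f i w) = imageOp i (zhuMap _ w) := by
  rw [f, imageOp, LinearMap.sub_apply, map_sub, zhuMap_mode_neg_one, gen, gen, mode_X,
    zhuMap_X_zero]
  simp [osc_of_nonneg, zhuMap_pderiv]

end Heisenberg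

theorem mainTheorem3 (n k : ℕ) (hk : k ≤ n) :
    VOA.IsMZ (Heisenberg.Y (Fin n ⊕ Fin n))
        ((⨆ i : Fin k, LinearMap.range (Heisenberg.f (Fin.castLE hk i))) ⊔
          VOA.C2 (Heisenberg.Y (Fin n ⊕ Fin n))) ↔
      MathieuZhao.IsMZ (R := ℂ)
        (⨆ i : Fin k, LinearMap.range (imageOp (Fin.castLE hk i))) :=
  Heisenberg.isC2QuotientMap_zhuMap.isMZ_iSup_range_sup_C2_iff fun _ => Heisenberg.zhuMap_f _
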